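/- All graphs are finite and simple unless stated otherwise. For graphs $F,G$ let $t(F,G)$ be the probability that a uniformly random map $V(F)\to V(G)$ is a graph homomorphism. A sequence of graphs $(G_m)$ with $|G_m|\to\infty$ converges if $t(F,G_m)$ converges for every graph $F$; a graph limit $\Gamma$ is the limit of such a sequence, is identified with the family of numbers $t(F,\Gamma)=\lim_m t(F,G_m)$, and $G_m\to\Gamma$ means that $|G_m|\to\infty$ and $t(F,G_m)\to t(F,\Gamma)$ for every $F$. A graph is an interval graph if its vertices $v$ can be assigned non-empty closed bounded intervals $I_v\subset\mathbb R$ (possibly of length $0$) such that distinct $v,w$ are adjacent if and only if $I_v\cap I_w\ne\emptyset$; it is a unit interval graph if one can take $I_v=[x_v,x_v+1]$ with $x_v\in\mathbb R$. A (unit) interval graph limit is a graph limit $\Gamma$ such that $G_m\to\Gamma$ for some sequence of (unit) interval graphs $G_m$. For $|F|\le|G|$, $t_{\mathrm{ind}}(F,G)$ is the probability that the subgraph of $G$ induced by $|F|$ distinct vertices chosen uniformly at random is isomorphic to $F$, and $t_{\mathrm{ind}}(F,\Gamma)=\lim_m t_{\mathrm{ind}}(F,G_m)$ whenever $G_m\to\Gamma$.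 Finally, $G(n,\Gamma)$ is the random graph on $n$ labelled vertices with $\mathbb P(F\subseteq G(n,\Gamma))=t(F,\Gamma)$ for every graph $F$ on the same vertex set; equivalently, for any symmetric measurable $W:S\times S\to[0,1]$ on a probability space $(S,\mu)$ representing $\Gamma$, it is obtained by drawing $X_1,\dots,X_n$ independently with law $\mu$ and then, conditionally independently for $i<j$, joining $i$ and $j$ with probability $W(X_i,X_j)$. **Theorem.** Let $\Gamma$ be a graph limit. The following are equivalent: (i) $\Gamma$ is a unit interval graph limit; (ii) $\Gamma$ is an interval graph limit and $t_{\mathrm{ind}}(K_{1,3},\Gamma)=0$; (iii) for every $n$, the random graph $G(n,\Gamma)$ is almost surely a unit interval graph. -/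

import Mathlib

open Filter Topology MeasureTheory

namespace GraphLimits

noncomputable section

/-! ### Intersection graphs -/

/-- `G` is an intersection graph of members of the family `A` of sets: the vertices can be labelled
by members of `A` so that two distinct vertices are adjacent iff their labels meet. -/
def IsIntersectionGraph {α V : Type*} (A : Set (Set α)) (G : SimpleGraph V) : Prop :=
  ∃ I : V → Set α, (∀ v, I v ∈ A) ∧ ∀ v w, v ≠ w → (G.Adj v w ↔ (I v ∩ I w).Nonempty)

/-- Interval graphs: intersection graphs of non-empty closed bounded intervals `[a, b]`, `a ≤ b`,
of real numbers (intervals of length `0` are allowed). -/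
def IsIntervalGraph {V : Type*} (G : SimpleGraph V) : Prop :=
  IsIntersectionGraph {J : Set ℝ | ∃ a b : ℝ, a ≤ b ∧ J = Set.Icc a b} G

/-- Unit interval graphs: intersection graphs of the intervals `[x, x + 1]`, `x` real. -/
def IsUnitIntervalGraph {V : Type*} (G : SimpleGraph V) : Prop :=
  IsIntersectionGraph {J : Set ℝ | ∃ x : ℝ, J = Set.Icc x (x + 1)} G

/-! ### Graph limits -/

/-- A finite graph, on the vertex set `{0, …, m - 1}`; `G.1` is its order and `G.2` the graph. -/
abbrev FinGraph : Type := Σ m : ℕ, SimpleGraph (Fin m)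

/-- `t(F, G)`: the probability that a uniformly random map `V(F) → V(G)` is a homomorphism. -/
def homDensity {k : ℕ} (F : SimpleGraph (Fin k)) (G : FinGraph) : ℝ :=
  (Nat.card (F →g G.2) : ℝ) / (G.1 : ℝ) ^ k

/-- A (proper) graph limit, given by the numbers `t(F, Γ)` which determine it: these are the limits
of `t(F, Gₙ)`, for all graphs `F`, for some sequence of graphs with `|Gₙ| → ∞`. -/
structure GraphLimit where
  t : ∀ {k : ℕ}, SimpleGraph (Fin k) → ℝ
  exists_seq : ∃ G : ℕ → FinGraph, Tendsto (fun n => (G n).1) atTop atTop ∧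
    ∀ (k : ℕ) (F : SimpleGraph (Fin k)), Tendsto (fun n => homDensity F (G n)) atTop (𝓝 (t F))

/-- `Gₙ → Γ`: the orders tend to infinity and `t(F, Gₙ) → t(F, Γ)` for every graph `F`. -/
def ConvergesTo (G : ℕ → FinGraph) (Γ : GraphLimit) : Prop :=
  Tendsto (fun n => (G n).1) atTop atTop ∧
    ∀ (k : ℕ) (F : SimpleGraph (Fin k)), Tendsto (fun n => homDensity F (G n)) atTop (𝓝 (Γ.t F))

/-- An interval graph limit is a limit of some sequence of interval graphs. -/
def IsIntervalGraphLimit (Γ : GraphLimit) : Prop :=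
  ∃ G : ℕ → FinGraph, (∀ n, IsIntervalGraph (G n).2) ∧ ConvergesTo G Γ

/-- A unit interval graph limit is a limit of some sequence of unit interval graphs. -/
def IsUnitIntervalGraphLimit (Γ : GraphLimit) : Prop :=
  ∃ G : ℕ → FinGraph, (∀ n, IsUnitIntervalGraph (G n).2) ∧ ConvergesTo G Γ

/-! ### The random graphs `G(n, Γ)` -/

open scoped Classical in
/-- Inclusion–exclusion: if `t F = P(F ⊆ R)` for all graphs `F` on `{0, …, n - 1}`, for a random
graph `R` on this vertex set, then `inclExcl t H = P(R = H)`. -/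
def inclExcl {n : ℕ} (t : SimpleGraph (Fin n) → ℝ) (H : SimpleGraph (Fin n)) : ℝ :=
  ∑ F : SimpleGraph (Fin n) with H ≤ F, (-1) ^ (F \ H).edgeFinset.card * t F

open scoped Classical in
lemma inclExcl_prod {n : ℕ} (w : Sym2 (Fin n) → ℝ) (H : SimpleGraph (Fin n)) :
    inclExcl (fun F => ∏ e ∈ F.edgeFinset, w e) H =
      (∏ e ∈ H.edgeFinset, w e) * ∏ e ∈ Hᶜ.edgeFinset, (1 - w e) := by
  have hexp : ∏ e ∈ Hᶜ.edgeFinset, (1 - w e) =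
      ∑ s ∈ Hᶜ.edgeFinset.powerset, (-1) ^ s.card * ∏ e ∈ s, w e := by
    have : ∀ e ∈ Hᶜ.edgeFinset, (1 - w e) = 1 + (- w e) := fun e _ => by ring
    rw [Finset.prod_congr rfl this, Finset.prod_one_add]
    refine Finset.sum_congr rfl fun s _ => ?_
    rw [Finset.prod_neg]
  rw [hexp, Finset.mul_sum, inclExcl]
  refine Finset.sum_bij' (fun F _ => (F \ H).edgeFinset)
    (fun s _ => H ⊔ SimpleGraph.fromEdgeSet (s : Set (Sym2 (Fin n)))) ?_ ?_ ?_ ?_ ?_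
  · intro F hF
    rw [Finset.mem_powerset, SimpleGraph.edgeFinset_subset_edgeFinset]
    intro a b h
    simp only [SimpleGraph.sdiff_adj] at h
    exact ⟨h.1.ne, h.2⟩
  · intro s hs
    simp
  · intro F hF
    simp only [Finset.mem_filter, Finset.mem_univ, true_and] at hF
    simp only [SimpleGraph.coe_edgeFinset, SimpleGraph.fromEdgeSet_edgeSet]
    exact sup_sdiff_cancel_right hF
  · intro s hs
    rw [Finset.mem_powerset] at hs
    ext e
    induction e with | _ a b =>
    simp only [SimpleGraph.mem_edgeFinset, SimpleGraph.mem_edgeSet, SimpleGraph.sdiff_adj,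
      SimpleGraph.sup_adj, SimpleGraph.fromEdgeSet_adj, Finset.mem_coe]
    constructor
    · rintro ⟨h | h, h'⟩
      · exact absurd h h'
      · exact h.1
    · intro h
      have := hs h
      simp only [SimpleGraph.mem_edgeFinset, SimpleGraph.mem_edgeSet, SimpleGraph.compl_adj] at this
      exact ⟨Or.inr ⟨h, this.1⟩, this.2⟩
  · intro F hF
    simp only [Finset.mem_filter, Finset.mem_univ, true_and] at hF
    have h1 : F.edgeFinset = H.edgeFinset ∪ (F \ H).edgeFinset := by
      rw [← SimpleGraph.edgeFinset_sup]
      ext e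
      simpa using fun h => SimpleGraph.edgeSet_mono hF h
    have h2 : Disjoint H.edgeFinset (F \ H).edgeFinset := by
      rw [SimpleGraph.disjoint_edgeFinset]; exact disjoint_sdiff_self_right
    have : ∏ e ∈ F.edgeFinset, w e =
        (∏ e ∈ H.edgeFinset, w e) * ∏ e ∈ (F \ H).edgeFinset, w e := by
      rw [h1, Finset.prod_union h2]
    rw [this]; ring

open scoped Classical in
lemma inclExcl_indicator {n : ℕ} (K H : SimpleGraph (Fin n)) :
    inclExcl (fun F => if F ≤ K then (1 : ℝ) else 0) H = if K = H then 1 else 0 := by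
  have key := inclExcl_prod (fun e => if e ∈ K.edgeSet then (1 : ℝ) else 0) H
  have h1 : ∀ F : SimpleGraph (Fin n),
      ∏ e ∈ F.edgeFinset, (if e ∈ K.edgeSet then (1 : ℝ) else 0) = if F ≤ K then 1 else 0 := by
    intro F
    rw [Finset.prod_ite_zero]
    simp only [Finset.prod_const_one, SimpleGraph.mem_edgeFinset]
    congr 1
    rw [← SimpleGraph.edgeSet_subset_edgeSet]; rfl
  simp only [h1] at key
  rw [key]
  have h2 : ∏ e ∈ Hᶜ.edgeFinset, (1 - if e ∈ K.edgeSet then (1 : ℝ) else 0) =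
      if K ≤ H then 1 else 0 := by
    have : ∀ e ∈ Hᶜ.edgeFinset, (1 - if e ∈ K.edgeSet then (1 : ℝ) else 0) =
        if e ∉ K.edgeSet then 1 else 0 := by
      intro e _; split_ifs <;> simp_all
    rw [Finset.prod_congr rfl this, Finset.prod_ite_zero]
    simp only [Finset.prod_const_one, SimpleGraph.mem_edgeFinset]
    congr 1
    apply propext
    constructor
    · intro h a b hab
      by_contra hH
      exact h s(a, b) (by simp [hab.ne, hH]) hab
    · intro h e
      induction e with | _ a b =>
      intro he hK
      simp only [SimpleGraph.mem_edgeSet, SimpleGraph.compl_adj] at he hK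
      exact he.2 (h hK)
  rw [h2]
  by_cases h : K = H
  · simp [h]
  · have : ¬ (H ≤ K ∧ K ≤ H) := fun h' => h (le_antisymm h'.2 h'.1)
    by_cases h3 : H ≤ K
    · have : ¬ K ≤ H := fun h' => this ⟨h3, h'⟩
      simp [h, this]
    · simp [h, h3]

lemma homDensity_eq {k : ℕ} (F : SimpleGraph (Fin k)) (G : FinGraph) : homDensity F G =
    (∑ φ : Fin k → Fin G.1, open scoped Classical in if F ≤ G.2.comap φ then (1 : ℝ) else 0)
      / (G.1 : ℝ) ^ k := by
  classical
  unfold homDensity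
  congr 1
  rw [Finset.sum_boole]
  norm_cast
  rw [← Fintype.card_subtype, ← Nat.card_eq_fintype_card]
  exact Nat.card_congr
    { toFun := fun f => ⟨f, fun a b h => f.map_rel h⟩
      invFun := fun f => ⟨f.1, fun {a b} h => f.2 h⟩
      left_inv := fun f => rfl
      right_inv := fun f => rfl }

/-- For a finite graph `G`, `inclExcl` of the homomorphism densities is the probability that the
graph induced by `n` vertices sampled with replacement equals `H`. -/
lemma inclExcl_homDensity {n : ℕ} (G : FinGraph) (H : SimpleGraph (Fin n)) :
    inclExcl (fun F => homDensity F G) H =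
      (∑ φ : Fin n → Fin G.1, open scoped Classical in if G.2.comap φ = H then (1 : ℝ) else 0)
        / (G.1 : ℝ) ^ n := by
  classical
  have := fun φ : Fin n → Fin G.1 => inclExcl_indicator (G.2.comap φ) H
  simp only [← this]
  simp only [inclExcl, homDensity_eq]
  rw [Finset.sum_comm, Finset.sum_div]
  refine Finset.sum_congr rfl fun F _ => ?_
  rw [← Finset.mul_sum, mul_div_assoc]

lemma ConvergesTo.tendsto_inclExcl {G : ℕ → FinGraph} {Γ : GraphLimit} (h : ConvergesTo G Γ)
    {n : ℕ} (H : SimpleGraph (Fin n)) :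
    Tendsto (fun m => inclExcl (fun F => homDensity F (G m)) H) atTop
      (𝓝 (inclExcl (fun F => Γ.t F) H)) :=
  tendsto_finsetSum _ fun F _ => (h.2 n F).const_mul _

lemma GraphLimit.inclExcl_nonneg (Γ : GraphLimit) {n : ℕ} (H : SimpleGraph (Fin n)) :
    0 ≤ inclExcl (fun F => Γ.t F) H := by
  obtain ⟨G, hG⟩ := Γ.exists_seq
  refine ge_of_tendsto' (ConvergesTo.tendsto_inclExcl (Γ := Γ) hG H) fun m => ?_
  rw [inclExcl_homDensity]
  refine div_nonneg (Finset.sum_nonneg fun φ _ => ?_) (by positivity)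
  split_ifs <;> simp

open scoped Classical in
lemma GraphLimit.sum_inclExcl (Γ : GraphLimit) (n : ℕ) :
    ∑ H : SimpleGraph (Fin n), inclExcl (fun F => Γ.t F) H = 1 := by
  obtain ⟨G, hG⟩ := Γ.exists_seq
  have h1 : Tendsto (fun m => ∑ H : SimpleGraph (Fin n), inclExcl (fun F => homDensity F (G m)) H)
      atTop (𝓝 (∑ H : SimpleGraph (Fin n), inclExcl (fun F => Γ.t F) H)) :=
    tendsto_finsetSum _ fun H _ => ConvergesTo.tendsto_inclExcl (Γ := Γ) hG H
  refine tendsto_nhds_unique h1 (tendsto_const_nhds.congr' ?_)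
  filter_upwards [hG.1.eventually_gt_atTop 0] with m hm
  simp only [inclExcl_homDensity]
  rw [← Finset.sum_div, Finset.sum_comm]
  have : ((G m).1 : ℝ) ≠ 0 := by positivity
  simp [this]

open scoped Classical in
/-- The law of the random graph `G(n, Γ)` on `{0, …, n - 1}`. It is the law with
`P(F ⊆ G(n, Γ)) = t(F, Γ)` for all `F`, and it is the law obtained by sampling from any kernel that
represents `Γ`; both facts are proved below. -/
def GraphLimit.randomGraph (Γ : GraphLimit) (n : ℕ) : PMF (SimpleGraph (Fin n)) :=
  PMF.ofFintype (fun H => ENNReal.ofReal (inclExcl (fun F => Γ.t F) H)) (by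
    rw [← ENNReal.ofReal_sum_of_nonneg fun H _ => Γ.inclExcl_nonneg H, Γ.sum_inclExcl,
      ENNReal.ofReal_one])

lemma GraphLimit.randomGraph_apply (Γ : GraphLimit) {n : ℕ} (H : SimpleGraph (Fin n)) :
    (Γ.randomGraph n H).toReal = inclExcl (fun F => Γ.t F) H := by
  simp [randomGraph, ENNReal.toReal_ofReal (Γ.inclExcl_nonneg H)]

open scoped Classical in
lemma GraphLimit.toReal_randomGraph (Γ : GraphLimit) {n : ℕ} (A : Set (SimpleGraph (Fin n))) :
    ((Γ.randomGraph n).toOuterMeasure A).toReal =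
      ∑ H : SimpleGraph (Fin n) with H ∈ A, inclExcl (fun F => Γ.t F) H := by
  rw [PMF.toOuterMeasure_apply_fintype, ENNReal.toReal_sum, Finset.sum_filter]
  · refine Finset.sum_congr rfl fun H _ => ?_
    rw [Set.indicator_apply]
    split_ifs
    · exact Γ.randomGraph_apply H
    · simp
  · intro H _
    rw [Set.indicator_apply]
    split_ifs
    · exact PMF.apply_ne_top _ _
    · simp

/-- The characterization of the law of `G(n, Γ)`: `P(F ⊆ G(n, Γ)) = t(F, Γ)`. -/
theorem GraphLimit.randomGraph_ge (Γ : GraphLimit) {n : ℕ} (F : SimpleGraph (Fin n)) :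
    ((Γ.randomGraph n).toOuterMeasure {H | F ≤ H}).toReal = Γ.t F := by
  classical
  rw [Γ.toReal_randomGraph]
  obtain ⟨G, hG⟩ := Γ.exists_seq
  have h1 : Tendsto (fun m => ∑ H : SimpleGraph (Fin n) with H ∈ {H | F ≤ H},
      inclExcl (fun F => homDensity F (G m)) H) atTop
      (𝓝 (∑ H : SimpleGraph (Fin n) with H ∈ {H | F ≤ H}, inclExcl (fun F => Γ.t F) H)) :=
    tendsto_finsetSum _ fun H _ => ConvergesTo.tendsto_inclExcl (Γ := Γ) hG H
  refine tendsto_nhds_unique h1 ((hG.2 n F).congr fun m => ?_)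
  simp only [inclExcl_homDensity]
  rw [← Finset.sum_div, Finset.sum_comm, homDensity_eq]
  congr 1
  refine Finset.sum_congr rfl fun φ _ => ?_
  rw [Finset.sum_ite_eq]
  simp

/-! ### Representation by kernels -/

/-- A kernel on `S`: a symmetric measurable function `S × S → [0, 1]`. -/
structure Kernel (S : Type*) [MeasurableSpace S] where
  toFun : S → S → ℝ
  symm : ∀ x y, toFun x y = toFun y x
  measurable : Measurable (Function.uncurry toFun)
  mem_Icc : ∀ x y, toFun x y ∈ Set.Icc (0 : ℝ) 1

/-- `W(x_i, x_j)` as a function of the unordered pair `ij`. -/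
def Kernel.edge {S : Type*} [MeasurableSpace S] (W : Kernel S) {n : ℕ} (x : Fin n → S) :
    Sym2 (Fin n) → ℝ :=
  Sym2.lift ⟨fun i j => W.toFun (x i) (x j), fun _ _ => W.symm _ _⟩

open scoped Classical in
/-- The kernel `W` on the probability space `(S, μ)` represents `Γ`:
`t(F, Γ) = ∫ ∏_{ij ∈ E(F)} W(x_i, x_j) dμ(x₁) ⋯ dμ(x_k)` for every graph `F`. -/
def Kernel.Represents {S : Type*} [MeasurableSpace S] (W : Kernel S) (μ : Measure S)
    (Γ : GraphLimit) : Prop :=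
  ∀ (k : ℕ) (F : SimpleGraph (Fin k)),
    Γ.t F = ∫ x : Fin k → S, ∏ e ∈ F.edgeFinset, W.edge x e ∂(Measure.pi fun _ => μ)

lemma Kernel.edge_mem {S : Type*} [MeasurableSpace S] (W : Kernel S) {n : ℕ} (x : Fin n → S)
    (e : Sym2 (Fin n)) : W.edge x e ∈ Set.Icc (0 : ℝ) 1 := by
  induction e with | _ a b => exact W.mem_Icc _ _

lemma Kernel.measurable_edge {S : Type*} [MeasurableSpace S] (W : Kernel S) {n : ℕ}
    (e : Sym2 (Fin n)) : Measurable fun x : Fin n → S => W.edge x e := by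
  induction e with | _ a b =>
  have h : Measurable fun x : Fin n → S => (x a, x b) :=
    (measurable_pi_apply a).prodMk (measurable_pi_apply b)
  exact W.measurable.comp h

open scoped Classical in
/-- If `W` represents `Γ`, then `G(n, Γ)` is the random graph `G(n, W, μ)`: choose `X₁, …, X_n`
independently with law `μ` and, conditionally on them, the edges independently, `ij` being an edge
with probability `W(X_i, X_j)`. -/
theorem Kernel.Represents.randomGraph_apply {S : Type*} [MeasurableSpace S] {W : Kernel S}
    {μ : Measure S} [IsProbabilityMeasure μ] {Γ : GraphLimit} (h : W.Represents μ Γ)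
    {n : ℕ} (H : SimpleGraph (Fin n)) :
    (Γ.randomGraph n H).toReal =
      ∫ x : Fin n → S, (∏ e ∈ H.edgeFinset, W.edge x e) * ∏ e ∈ Hᶜ.edgeFinset, (1 - W.edge x e)
        ∂(Measure.pi fun _ => μ) := by
  rw [Γ.randomGraph_apply]
  simp only [← inclExcl_prod]
  simp only [inclExcl, h n]
  rw [integral_finsetSum]
  · refine Finset.sum_congr rfl fun F _ => ?_
    rw [integral_const_mul]
  · intro F _
    refine Integrable.const_mul ?_ _
    refine Integrable.of_bound (C := 1)
      (Finset.measurable_fun_prod _ fun e _ => W.measurable_edge e).aestronglyMeasurable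
      (ae_of_all _ fun x => ?_)
    rw [Real.norm_of_nonneg (Finset.prod_nonneg fun e _ => (W.edge_mem x e).1)]
    exact Finset.prod_le_one (fun e _ => (W.edge_mem x e).1) fun e _ => (W.edge_mem x e).2

/-! ### Induced subgraph densities -/

/-- `t_ind(F, G)` for a finite graph `G`: the probability that the subgraph of `G` induced by `|F|`
distinct vertices chosen uniformly at random is isomorphic to `F`. -/
def indDensity {V : Type*} [Fintype V] (F : SimpleGraph V) (G : FinGraph) : ℝ :=
  (Nat.card {s : Finset (Fin G.1) // s.card = Fintype.card V ∧
      Nonempty (G.2.induce (s : Set (Fin G.1)) ≃g F)} : ℝ) / (G.1.choose (Fintype.card V) : ℝ)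

/-- `t_ind(F, Γ)` for a graph limit `Γ`: the probability that `G(|F|, Γ)` is isomorphic to `F`. It
is the extension of `t_ind(F, ·)` by continuity, see `ConvergesTo.tendsto_indDensity`. -/
def GraphLimit.indDensity {V : Type*} [Fintype V] (F : SimpleGraph V) (Γ : GraphLimit) : ℝ :=
  ((Γ.randomGraph (Fintype.card V)).toOuterMeasure {H | Nonempty (H ≃g F)}).toReal

/-- Counting injective samples: each `k`-set of vertices is the image of `k!` injections. -/
lemma card_injective_iso {V : Type*} [Fintype V] (F : SimpleGraph V) (G : FinGraph) :
    Nat.card {φ : Fin (Fintype.card V) → Fin G.1 //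
        Function.Injective φ ∧ Nonempty (G.2.comap φ ≃g F)} =
      (Fintype.card V).factorial * Nat.card {s : Finset (Fin G.1) // s.card = Fintype.card V ∧
        Nonempty (G.2.induce (s : Set (Fin G.1)) ≃g F)} := by
  classical
  set k := Fintype.card V
  let T := {s : Finset (Fin G.1) // s.card = k ∧
        Nonempty (G.2.induce (s : Set (Fin G.1)) ≃g F)}
  let f : (Σ s : T, (Fin k ≃ (s.1 : Set (Fin G.1)))) →
      {φ : Fin k → Fin G.1 // Function.Injective φ ∧ Nonempty (G.2.comap φ ≃g F)} := fun p =>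
    ⟨fun i => (p.2 i : Fin G.1), Subtype.val_injective.comp p.2.injective,
      p.1.2.2.map fun e => RelIso.trans (⟨p.2, Iff.rfl⟩ : G.2.comap (fun i => (p.2 i : Fin G.1)) ≃g
        G.2.induce (p.1.1 : Set (Fin G.1))) e⟩
  have hf : Function.Bijective f := by
    constructor
    · rintro ⟨⟨s, hs⟩, e⟩ ⟨⟨s', hs'⟩, e'⟩ h
      have h0 : ∀ i, (e i : Fin G.1) = e' i := fun i => congrFun (congrArg Subtype.val h) i
      have hss : s = s' := by
        ext a
        constructor
        · intro ha
          obtain ⟨i, hi⟩ := e.surjective ⟨a, ha⟩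
          have := h0 i
          rw [hi] at this
          rw [show a = _ from this]
          exact (e' i).2
        · intro ha
          obtain ⟨i, hi⟩ := e'.surjective ⟨a, ha⟩
          have := h0 i
          rw [hi] at this
          rw [← show _ = a from this]
          exact (e i).2
      subst hss
      congr 1
      ext i
      exact congrArg Fin.val (h0 i)
    · rintro ⟨φ, hφ, ⟨e⟩⟩
      have hmem : ∀ i, φ i ∈ ((Finset.univ.image φ : Finset _) : Set (Fin G.1)) := by simp
      let g : Fin k ≃ ((Finset.univ.image φ : Finset _) : Set (Fin G.1)) :=
        Equiv.ofBijective (fun i => ⟨φ i, hmem i⟩)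
          ⟨fun i j h => hφ (congrArg Subtype.val h), by
            rintro ⟨a, ha⟩
            simp only [Finset.coe_image, Finset.coe_univ, Set.image_univ, Set.mem_range] at ha
            obtain ⟨i, rfl⟩ := ha
            exact ⟨i, rfl⟩⟩
      have gi : G.2.comap φ ≃g
          G.2.induce ((Finset.univ.image φ : Finset _) : Set (Fin G.1)) := ⟨g, Iff.rfl⟩
      exact ⟨⟨⟨Finset.univ.image φ, by rw [Finset.card_image_of_injective _ hφ]; simp,
        ⟨gi.symm.trans e⟩⟩, g⟩, rfl⟩
  rw [← Nat.card_congr (Equiv.ofBijective f hf), Nat.card_sigma]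
  have : ∀ s : T, Nat.card (Fin k ≃ (s.1 : Set (Fin G.1))) = k.factorial := by
    intro s
    have e : Fin k ≃ (s.1 : Set (Fin G.1)) := (Finset.equivFinOfCardEq s.2.1).symm
    rw [Nat.card_eq_fintype_card, Fintype.card_equiv e, Fintype.card_fin]
  rw [Finset.sum_congr rfl fun s _ => this s]
  simp [T, mul_comm]

/-- `t_ind(F, Γ)` is the extension of `t_ind(F, ·)` by continuity. -/
theorem ConvergesTo.tendsto_indDensity {V : Type*} [Fintype V] (F : SimpleGraph V)
    {G : ℕ → FinGraph} {Γ : GraphLimit} (h : ConvergesTo G Γ) :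
    Tendsto (fun m => GraphLimits.indDensity F (G m)) atTop (𝓝 (Γ.indDensity F)) := by
  classical
  set k := Fintype.card V with hk
  -- sampling with replacement
  let B : FinGraph → ℝ := fun G => Nat.card {φ : Fin k → Fin G.1 // Nonempty (G.2.comap φ ≃g F)}
  have hB : Tendsto (fun m => B (G m) / ((G m).1 : ℝ) ^ k) atTop (𝓝 (Γ.indDensity F)) := by
    rw [GraphLimit.indDensity, Γ.toReal_randomGraph]
    have h1 : Tendsto (fun m => ∑ H : SimpleGraph (Fin k) with H ∈ {H | Nonempty (H ≃g F)},
        inclExcl (fun F => homDensity F (G m)) H) atTop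
        (𝓝 (∑ H : SimpleGraph (Fin k) with H ∈ {H | Nonempty (H ≃g F)},
          inclExcl (fun F => Γ.t F) H)) :=
      tendsto_finsetSum _ fun H _ => h.tendsto_inclExcl H
    refine h1.congr fun m => ?_
    simp only [inclExcl_homDensity]
    rw [← Finset.sum_div, Finset.sum_comm]
    congr 1
    simp only [Finset.sum_ite_eq, Finset.mem_filter, Finset.mem_univ, true_and, Set.mem_ofPred_eq]
    rw [Finset.sum_boole, ← Fintype.card_subtype, ← Nat.card_eq_fintype_card]
  -- sampling without replacement
  let A : FinGraph → ℝ := fun G => Nat.card {φ : Fin k → Fin G.1 //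
    Function.Injective φ ∧ Nonempty (G.2.comap φ ≃g F)}
  have hA : ∀ G, A G ≤ B G ∧ B G ≤ A G + ((G.1 : ℝ) ^ k - (G.1.descFactorial k : ℝ)) := by
    intro G
    have eA : A G = ((Finset.univ.filter fun φ : Fin k → Fin G.1 =>
        Function.Injective φ ∧ Nonempty (G.2.comap φ ≃g F)).card : ℝ) := by
      simp only [A]
      rw [Nat.card_eq_fintype_card, Fintype.card_subtype]
    have eB : B G = ((Finset.univ.filter fun φ : Fin k → Fin G.1 =>
        Nonempty (G.2.comap φ ≃g F)).card : ℝ) := by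
      simp only [B]
      rw [Nat.card_eq_fintype_card, Fintype.card_subtype]
    have eI : (G.1.descFactorial k : ℝ) = ((Finset.univ.filter fun φ : Fin k → Fin G.1 =>
        Function.Injective φ).card : ℝ) := by
      rw [← Fintype.card_subtype,
        ← Fintype.card_congr (Equiv.subtypeInjectiveEquivEmbedding (Fin k) (Fin G.1)).symm,
        Fintype.card_embedding_eq]
      simp
    have eN : (G.1 : ℝ) ^ k = ((Finset.univ.filter fun φ : Fin k → Fin G.1 =>
        Function.Injective φ).card : ℝ) + ((Finset.univ.filter fun φ : Fin k → Fin G.1 =>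
        ¬ Function.Injective φ).card : ℝ) := by
      have := Finset.card_filter_add_card_filter_not (s := (Finset.univ : Finset (Fin k → Fin G.1)))
        (fun φ => Function.Injective φ)
      rw [Finset.card_univ] at this
      simp only [Fintype.card_pi, Fintype.card_fin, Finset.prod_const, Finset.card_univ] at this
      exact_mod_cast this.symm
    rw [eA, eB, eI, eN]
    constructor
    · exact_mod_cast Finset.card_le_card fun φ hφ => by
        simp only [Finset.mem_filter] at hφ ⊢
        exact ⟨hφ.1, hφ.2.2⟩
    · rw [add_sub_cancel_left]
      norm_cast
      refine le_trans (Finset.card_le_card ?_) (Finset.card_union_le _ _)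
      intro φ hφ
      simp only [Finset.mem_filter, Finset.mem_union, Finset.mem_univ, true_and] at hφ ⊢
      by_cases hi : Function.Injective φ
      · exact Or.inl ⟨hi, hφ⟩
      · exact Or.inr hi
  have hI : ∀ G : FinGraph, GraphLimits.indDensity F G = A G / (G.1.descFactorial k : ℝ) := by
    intro G
    have hcard := card_injective_iso F G
    simp only [A, GraphLimits.indDensity]
    rw [← hk] at hcard ⊢
    rw [hcard, Nat.descFactorial_eq_factorial_mul_choose]
    push_cast
    rw [mul_div_mul_left]
    exact_mod_cast Nat.factorial_ne_zero k
  have hD : Tendsto (fun m => ((G m).1.descFactorial k : ℝ) / ((G m).1 : ℝ) ^ k) atTop (𝓝 1) := by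
    have h2 : Tendsto (fun N : ℕ => (N.descFactorial k : ℝ) / (N : ℝ) ^ k) atTop (𝓝 1) := by
      refine (Asymptotics.isEquivalent_iff_tendsto_one ?_).1 (isEquivalent_descFactorial k)
      filter_upwards [eventually_gt_atTop 0] with N hN
      positivity
    exact h2.comp h.1
  have hAt : Tendsto (fun m => A (G m) / ((G m).1 : ℝ) ^ k) atTop (𝓝 (Γ.indDensity F)) := by
    have hlow : Tendsto (fun m => B (G m) / ((G m).1 : ℝ) ^ k -
        (1 - ((G m).1.descFactorial k : ℝ) / ((G m).1 : ℝ) ^ k)) atTop (𝓝 (Γ.indDensity F)) := by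
      simpa using hB.sub (hD.const_sub 1)
    refine tendsto_of_tendsto_of_tendsto_of_le_of_le' hlow hB ?_ ?_
    · filter_upwards [h.1.eventually_gt_atTop 0] with m hm
      have hpos : (0 : ℝ) < ((G m).1 : ℝ) ^ k := by positivity
      rw [one_sub_div hpos.ne', ← sub_div]
      gcongr
      linarith [(hA (G m)).2]
    · filter_upwards with m
      gcongr
      exact (hA (G m)).1
  have := hAt.div hD one_ne_zero
  rw [div_one] at this
  refine this.congr' ?_
  filter_upwards [h.1.eventually_gt_atTop 0] with m hm
  have hpos : (0 : ℝ) < ((G m).1 : ℝ) ^ k := by positivity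
  rw [hI]
  simp only [Pi.div_apply]
  rw [div_div_div_cancel_right₀ hpos.ne']

end

end GraphLimits

namespace GraphLimits

/-! ### Claw-free interval graphs are unit interval graphs -/

/-! The equivalence is the limit version of Roberts' theorem that the unit interval graphs are the
claw-free interval graphs. The translation between finite graphs and `Γ` goes through the support of
`G(n, Γ)`, without kernels or compactness. If unit interval graphs converge to `Γ`, their claw
densities vanish, hence so does that of `Γ`. Conversely, a graph in the support of `G(n, Γ)` is an
induced subgraph of some member of any sequence converging to `Γ`, because sampled vertices are
almost always distinct (`ConvergesTo.exists_comap_eq`); so it is an interval graph if that sequence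
is. It has no induced claw, since a claw would survive restriction to its four vertices and have
positive density (`GraphLimit.isEmpty_embedding_of_indDensity_eq_zero`). Roberts' theorem then
applies. Finally, `Γ` is a limit of graphs chosen from these supports
(`GraphLimit.exists_convergesTo_support`), by a second moment argument: the density of two disjoint
copies of `F` is the square of that of `F`, so the density of `F` in `G(n, Γ)` has mean square error
tending to 0. -/

/-- Points are placed one at a time from left to right. The strict inequalities keep room for the
next point, and indexing by `ℕ` lets the induction extend the placement by a single update. -/
lemma exists_unit_positions (adj : ℕ → ℕ → Prop)
    (h : ∀ i j k, i < j → j < k → adj i k → adj i j ∧ adj j k) (n : ℕ) :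
    ∃ x : ℕ → ℝ, ∀ i j, i < j → j < n →
      x i < x j ∧ (adj i j → x j < x i + 1) ∧ (¬ adj i j → x i + 1 < x j) := by
  classical
  induction n with
  | zero => exact ⟨fun _ => 0, by simp⟩
  | succ n ih =>
    obtain ⟨x, hx⟩ := ih
    have hmono : ∀ i j, i ≤ j → j < n → x i ≤ x j := fun i j hij hj =>
      hij.eq_or_lt.elim (fun e => e ▸ le_rfl) fun l => (hx i j l hj).1.le
    -- The new point must exceed all earlier points and the right ends at its non-neighbours, and
    -- stay below the right ends at its neighbours. The hypothesis on `adj` puts every lower bound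
    -- below every upper bound.
    obtain ⟨y, hy1, hy2⟩ := Finset.exists_between'
      ((Finset.range n).image x ∪
        ((Finset.range n).filter fun j => ¬ adj j n).image fun j => x j + 1)
      (((Finset.range n).filter fun j => adj j n).image fun j => x j + 1) (by
        simp only [Finset.mem_union, Finset.mem_image, Finset.mem_filter, Finset.mem_range]
        rintro _ (⟨j, hj, rfl⟩ | ⟨j, ⟨hj, hjn⟩, rfl⟩) _ ⟨i, ⟨hi, hin⟩, rfl⟩
        · rcases le_or_gt j i with hji | hij
          · linarith [hmono j i hji hi]
          · exact (hx i j hij hj).2.1 (h i j n hij hj hin).1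
        · rcases lt_trichotomy j i with hji | rfl | hij
          · linarith [(hx j i hji hi).1]
          · exact absurd hin hjn
          · exact absurd (h i j n hij hj hin).2 hjn)
    refine ⟨Function.update x n y, fun i j hij hj => ?_⟩
    have hi : i < n := by omega
    rw [Function.update_of_ne hi.ne]
    rcases (Nat.lt_succ_iff_lt_or_eq.1 hj) with hj | rfl
    · rw [Function.update_of_ne hj.ne]
      exact hx i j hij hj
    · rw [Function.update_self]
      refine ⟨hy1 _ ?_, fun ha => hy2 _ ?_, fun ha => hy1 _ ?_⟩
      · exact Finset.mem_union_left _ (Finset.mem_image_of_mem _ (by simpa))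
      · exact Finset.mem_image.2 ⟨i, by simp [hi, ha], rfl⟩
      · exact Finset.mem_union_right _ (Finset.mem_image.2 ⟨i, by simp [hi, ha], rfl⟩)

/-! ### Endpoint descriptions and induced subgraphs. -/

lemma Icc_inter_Icc_nonempty_iff {a b c d : ℝ} (h : a ≤ b) (h' : c ≤ d) :
    (Set.Icc a b ∩ Set.Icc c d).Nonempty ↔ c ≤ b ∧ a ≤ d := by
  rw [Set.Icc_inter_Icc, Set.nonempty_Icc, sup_le_iff, le_inf_iff, le_inf_iff]
  tauto

lemma isIntervalGraph_iff {V : Type*} {G : SimpleGraph V} :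
    IsIntervalGraph G ↔ ∃ a b : V → ℝ, (∀ v, a v ≤ b v) ∧
      ∀ v w, v ≠ w → (G.Adj v w ↔ a w ≤ b v ∧ a v ≤ b w) := by
  constructor
  · rintro ⟨I, hI, hG⟩
    choose a b hab hI using hI
    refine ⟨a, b, hab, fun v w hvw => ?_⟩
    rw [hG v w hvw, hI, hI, Icc_inter_Icc_nonempty_iff (hab v) (hab w)]
  · rintro ⟨a, b, hab, hG⟩
    refine ⟨fun v => Set.Icc (a v) (b v), fun v => ⟨a v, b v, hab v, rfl⟩, fun v w hvw => ?_⟩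
    rw [hG v w hvw, Icc_inter_Icc_nonempty_iff (hab v) (hab w)]

lemma isUnitIntervalGraph_iff {V : Type*} {G : SimpleGraph V} :
    IsUnitIntervalGraph G ↔ ∃ x : V → ℝ,
      ∀ v w, v ≠ w → (G.Adj v w ↔ x w ≤ x v + 1 ∧ x v ≤ x w + 1) := by
  have key : ∀ y : ℝ, y ≤ y + 1 := fun y => by linarith
  constructor
  · rintro ⟨I, hI, hG⟩
    choose x hI using hI
    refine ⟨x, fun v w hvw => ?_⟩
    rw [hG v w hvw, hI, hI, Icc_inter_Icc_nonempty_iff (key _) (key _)]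
  · rintro ⟨x, hG⟩
    refine ⟨fun v => Set.Icc (x v) (x v + 1), fun v => ⟨x v, rfl⟩, fun v w hvw => ?_⟩
    rw [hG v w hvw, Icc_inter_Icc_nonempty_iff (key _) (key _)]

lemma IsUnitIntervalGraph.isIntervalGraph {V : Type*} {G : SimpleGraph V}
    (h : IsUnitIntervalGraph G) : IsIntervalGraph G := by
  obtain ⟨x, hx⟩ := isUnitIntervalGraph_iff.1 h
  exact isIntervalGraph_iff.2 ⟨x, fun v => x v + 1, fun v => by linarith, hx⟩

/-- Injectivity matters: two vertices with the same image would be non-adjacent but carry the same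
label, which meets itself when non-empty. -/
lemma IsIntersectionGraph.comap {α V W : Type*} {A : Set (Set α)} {G : SimpleGraph V}
    (h : IsIntersectionGraph A G) {φ : W → V} (hφ : Function.Injective φ) :
    IsIntersectionGraph A (G.comap φ) := by
  obtain ⟨I, hI, hG⟩ := h
  exact ⟨fun w => I (φ w), fun w => hI _, fun v w hvw => hG _ _ (hφ.ne hvw)⟩

/-- A graph with a vertex order such that the vertices between two neighbours are adjacent to both
is a unit interval graph. -/
lemma isUnitIntervalGraph_of_umbrella {n : ℕ} {H : SimpleGraph (Fin n)}
    (h : ∀ i j k, i < j → j < k → H.Adj i k → H.Adj i j ∧ H.Adj j k) : IsUnitIntervalGraph H := by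
  obtain ⟨x, hx⟩ := exists_unit_positions
    (fun i j => ∃ (hi : i < n) (hj : j < n), H.Adj ⟨i, hi⟩ ⟨j, hj⟩)
    (fun i j k hij hjk ⟨hi, hk, hik⟩ => by
      have := h ⟨i, hi⟩ ⟨j, hjk.trans hk⟩ ⟨k, hk⟩ hij hjk hik
      exact ⟨⟨hi, hjk.trans hk, this.1⟩, ⟨hjk.trans hk, hk, this.2⟩⟩) n
  have key : ∀ i j : Fin n, i < j → (H.Adj i j ↔ x j ≤ x i + 1 ∧ x i ≤ x j + 1) := by
    intro i j hij
    obtain ⟨h1, h2, h3⟩ := hx i j hij j.2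
    refine ⟨fun ha => ⟨(h2 ⟨i.2, j.2, ha⟩).le, by linarith⟩, fun hd => ?_⟩
    by_contra ha
    exact absurd (h3 fun ⟨_, _, ha'⟩ => ha ha') (not_lt.2 hd.1)
  refine isUnitIntervalGraph_iff.2 ⟨fun i => x i, fun i j hij => ?_⟩
  rcases lt_or_gt_of_ne hij with hij | hij
  · exact key i j hij
  · rw [H.adj_comm, key j i hij, and_comm]

/-- The left ends of the three leaves differ pairwise by more than 1, so the outer two differ by
more than 2; yet both lie within 1 of the centre's. -/
lemma not_isUnitIntervalGraph_claw :
    ¬ IsUnitIntervalGraph (completeBipartiteGraph (Fin 1) (Fin 3)) := by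
  rw [isUnitIntervalGraph_iff]
  rintro ⟨x, hx⟩
  have hc : ∀ i : Fin 3, _ := fun i => (hx (Sum.inl 0) (Sum.inr i) (by simp)).1 (by simp)
  have hn : ∀ i j : Fin 3, i ≠ j → _ := fun i j hij =>
    (hx (Sum.inr i) (Sum.inr j) (by simpa using hij)).not.1 (by simp)
  have h0 := hc 0
  have h1 := hc 1
  have h2 := hc 2
  have h01 := hn 0 1 (by decide)
  have h02 := hn 0 2 (by decide)
  have h12 := hn 1 2 (by decide)
  simp only [not_and_or, not_le] at h01 h02 h12
  rcases h01 with h01 | h01 <;> rcases h02 with h02 | h02 <;> rcases h12 with h12 | h12 <;> linarith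

/-- Roberts' theorem: claw-free interval graphs are unit interval graphs. -/
theorem IsIntervalGraph.isUnitIntervalGraph {n : ℕ} {H : SimpleGraph (Fin n)}
    (hH : IsIntervalGraph H)
    (hclaw : IsEmpty (completeBipartiteGraph (Fin 1) (Fin 3) ↪g H)) :
    IsUnitIntervalGraph H := by
  classical
  obtain ⟨a, b, hab, hadj⟩ := isIntervalGraph_iff.1 hH
  -- `P v` and `S v` collect the vertices whose intervals lie wholly to the left and wholly to the
  -- right of that of `v`. Each family is a chain under inclusion.
  let P : Fin n → Finset (Fin n) := fun v => Finset.univ.filter fun u => b u < a v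
  let S : Fin n → Finset (Fin n) := fun v => Finset.univ.filter fun w => b v < a w
  have hP : ∀ u v, P u ⊆ P v ∨ P v ⊆ P u := fun u v => by
    rcases le_total (a u) (a v) with h | h
    · exact Or.inl fun w hw => by simp only [P, Finset.mem_filter_univ] at hw ⊢; linarith
    · exact Or.inr fun w hw => by simp only [P, Finset.mem_filter_univ] at hw ⊢; linarith
  have hS : ∀ u v, S u ⊆ S v ∨ S v ⊆ S u := fun u v => by
    rcases le_total (b u) (b v) with h | h
    · exact Or.inr fun w hw => by simp only [S, Finset.mem_filter_univ] at hw ⊢; linarith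
    · exact Or.inl fun w hw => by simp only [S, Finset.mem_filter_univ] at hw ⊢; linarith
  -- The failures give `u` left of `y` and `w` right of `y`, both meeting `x`. Then `x` also meets
  -- `y`, and `x` with leaves `u`, `y`, `w` is a claw.
  have hPS : ∀ x y, ¬ P y ⊆ P x → ¬ S y ⊆ S x → False := by
    intro x y h1 h2
    obtain ⟨u, hu, hu'⟩ := Finset.not_subset.1 h1
    obtain ⟨w, hw, hw'⟩ := Finset.not_subset.1 h2
    simp only [P, S, Finset.mem_filter_univ, not_lt] at hu hu' hw hw'
    have := hab x
    have := hab y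
    have := hab u
    have := hab w
    have huy : u ≠ y := by rintro rfl; linarith
    have hyw : y ≠ w := by rintro rfl; linarith
    have huw : u ≠ w := by rintro rfl; linarith
    have hxu : x ≠ u := by rintro rfl; linarith
    have hxy : x ≠ y := by rintro rfl; linarith
    have hxw : x ≠ w := by rintro rfl; linarith
    have e1 : H.Adj x u := (hadj x u hxu).2 ⟨by linarith, by linarith⟩
    have e2 : H.Adj x y := (hadj x y hxy).2 ⟨by linarith, by linarith⟩
    have e3 : H.Adj x w := (hadj x w hxw).2 ⟨by linarith, by linarith⟩
    have n1 : ¬ H.Adj u y := fun h => by linarith [((hadj u y huy).1 h).1]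
    have n2 : ¬ H.Adj y w := fun h => by linarith [((hadj y w hyw).1 h).1]
    have n3 : ¬ H.Adj u w := fun h => by linarith [((hadj u w huw).1 h).1]
    let f : Fin 1 ⊕ Fin 3 → Fin n := Sum.elim (fun _ => x) ![u, y, w]
    have n1' : ¬ H.Adj y u := fun h => n1 h.symm
    have n2' : ¬ H.Adj w y := fun h => n2 h.symm
    have n3' : ¬ H.Adj w u := fun h => n3 h.symm
    have hf : ∀ i j, H.Adj (f i) (f j) ↔ (completeBipartiteGraph (Fin 1) (Fin 3)).Adj i j := by
      rintro (i | i) (j | j) <;> fin_cases i <;> fin_cases j <;>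
        simp [f, e1, e2, e3, e1.symm, e2.symm, e3.symm, n1, n2, n3, n1', n2', n3']
    have hinj : Function.Injective f := by
      rintro (i | i) (j | j) hij <;> fin_cases i <;> fin_cases j <;> simp [f] at hij ⊢ <;>
        first | exact absurd hij (by assumption) | exact absurd hij.symm (by assumption)
    exact hclaw.false ⟨⟨f, hinj⟩, hf _ _⟩
  -- By `hPS` the two chains are ordered compatibly, so this score recovers the common order; a tie
  -- forces equality of both sets.
  let s : Fin n → ℤ := fun v => (P v).card - (S v).card
  have hs : ∀ u v, s u ≤ s v → P u ⊆ P v ∧ S v ⊆ S u := by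
    intro u v huv
    by_contra hcon
    have hor : P v ⊆ P u ∧ S u ⊆ S v := by
      have h1 := hPS u v
      have h2 := hPS v u
      have h3 := hP u v
      have h4 := hS u v
      tauto
    rw [not_and_or] at hcon
    have c1 := Finset.card_le_card hor.1
    have c2 := Finset.card_le_card hor.2
    simp only [s] at huv
    rcases hcon with h | h
    · have := Finset.card_lt_card ⟨hor.1, h⟩
      omega
    · have := Finset.card_lt_card ⟨hor.2, h⟩
      omega
  let σ := Tuple.sort s
  have hσ : Monotone (s ∘ σ) := Tuple.monotone_sort s
  have humb : IsUnitIntervalGraph (H.comap σ) := by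
    refine isUnitIntervalGraph_of_umbrella fun i j k hij hjk hik => ?_
    obtain ⟨p1, s1⟩ := hs _ _ (hσ hij.le)
    obtain ⟨p2, s2⟩ := hs _ _ (hσ hjk.le)
    have nij := σ.injective.ne hij.ne
    have njk := σ.injective.ne hjk.ne
    have nik := σ.injective.ne (hij.trans hjk).ne
    simp only [SimpleGraph.comap_adj] at hik ⊢
    rw [hadj _ _ nik] at hik
    rw [hadj _ _ nij, hadj _ _ njk]
    have q1 : ∀ w, b w < a (σ i) → b w < a (σ j) := by simpa [P, Finset.subset_iff] using p1
    have q2 : ∀ w, b w < a (σ j) → b w < a (σ k) := by simpa [P, Finset.subset_iff] using p2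
    have t1 : ∀ w, b (σ j) < a w → b (σ i) < a w := by simpa [S, Finset.subset_iff] using s1
    have t2 : ∀ w, b (σ k) < a w → b (σ j) < a w := by simpa [S, Finset.subset_iff] using s2
    -- A violated inequality, carried along the inclusions, either separates the first and third
    -- intervals or puts the middle interval strictly beyond itself.
    refine ⟨⟨?_, ?_⟩, ?_, ?_⟩ <;> by_contra! hcon
    · linarith [q2 _ hcon]
    · linarith [q1 _ hcon, hab (σ j)]
    · linarith [t1 _ hcon]
    · linarith [t2 _ hcon, hab (σ j)]
  have := IsIntersectionGraph.comap humb σ.symm.injective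
  rwa [SimpleGraph.comap_comap, Equiv.self_comp_symm, SimpleGraph.comap_id] at this

/-! ### Averages over maps -/

/-- A uniform random map restricts along an injection to a uniform random map, because the values
off the range are free. -/
lemma sum_comp_div_pow {V W M : Type*} [Fintype V] [Fintype W] [Fintype M] [DecidableEq V]
    [DecidableEq W] [Nonempty M] (ι : V ↪ W) (f : (V → M) → ℝ) :
    (∑ φ : W → M, f (φ ∘ ι)) / (Fintype.card M : ℝ) ^ Fintype.card W =
      (∑ φ : V → M, f φ) / (Fintype.card M : ℝ) ^ Fintype.card V := by
  classical
  let e : (W → M) ≃ ({w // w ∈ Set.range ι} → M) × ({w // w ∉ Set.range ι} → M) :=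
    Equiv.piEquivPiSubtypeProd _ _
  let e' : ({w // w ∈ Set.range ι} → M) ≃ (V → M) :=
    (Equiv.arrowCongr (Equiv.ofInjective ι ι.injective) (Equiv.refl M)).symm
  have hsum : ∑ φ : W → M, f (φ ∘ ι) =
      (Fintype.card M : ℝ) ^ Fintype.card {w // w ∉ Set.range ι} * ∑ φ : V → M, f φ := by
    rw [Fintype.sum_equiv (e.trans (e'.prodCongr (Equiv.refl _))) (fun φ : W → M => f (φ ∘ ι))
      (fun p => f p.1) (fun φ => rfl), Fintype.sum_prod_type]
    simp [Finset.mul_sum]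
  have hcard : Fintype.card W = Fintype.card {w // w ∉ Set.range ι} + Fintype.card V := by
    have h1 := Fintype.card_subtype_compl (fun w => w ∈ Set.range ι)
    have h2 : Fintype.card {w // w ∈ Set.range ι} = Fintype.card V :=
      (Fintype.card_congr (Equiv.ofInjective ι ι.injective)).symm
    have h3 := Fintype.card_subtype_le (fun w => w ∈ Set.range ι)
    omega
  have : (Fintype.card M : ℝ) ≠ 0 := by simp
  rw [hsum, hcard, pow_add, mul_div_mul_left _ _ (by positivity)]

lemma card_injective_fin (V : Type*) [Fintype V] [DecidableEq V] (m : ℕ) [DecidablePred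
    (Function.Injective : (V → Fin m) → Prop)] :
    (Finset.univ.filter fun φ : V → Fin m => Function.Injective φ).card =
      m.descFactorial (Fintype.card V) := by
  rw [← Fintype.card_subtype, Fintype.card_congr (Equiv.subtypeInjectiveEquivEmbedding V (Fin m)),
    Fintype.card_embedding_eq, Fintype.card_fin]

lemma tendsto_descFactorial_div_pow (k : ℕ) :
    Tendsto (fun N : ℕ => (N.descFactorial k : ℝ) / (N : ℝ) ^ k) atTop (𝓝 1) := by
  refine (Asymptotics.isEquivalent_iff_tendsto_one ?_).1 (isEquivalent_descFactorial k)
  filter_upwards [eventually_gt_atTop 0] with N hN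
  positivity

/-- Almost all maps into a large set are injective. -/
lemma tendsto_average_of_injective {V : Type*} [Fintype V] [DecidableEq V] {m : ℕ → ℕ}
    (hm : Tendsto m atTop atTop) (f : ∀ j, (V → Fin (m j)) → ℝ) {c : ℝ}
    (hf : ∀ j φ, f j φ ∈ Set.Icc (0 : ℝ) 1)
    (hc : ∀ j φ, Function.Injective φ → f j φ = c) :
    Tendsto (fun j => (∑ φ, f j φ) / (m j : ℝ) ^ Fintype.card V) atTop (𝓝 c) := by
  classical
  set k := Fintype.card V
  have hD := (tendsto_descFactorial_div_pow k).comp hm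
  have h1 : Tendsto (fun j => ((m j).descFactorial k : ℝ) / (m j : ℝ) ^ k * c) atTop (𝓝 c) := by
    simpa using hD.mul_const c
  have h2 : Tendsto (fun j => ((m j).descFactorial k : ℝ) / (m j : ℝ) ^ k * c +
      (1 - ((m j).descFactorial k : ℝ) / (m j : ℝ) ^ k)) atTop (𝓝 c) := by
    simpa using h1.add (hD.const_sub 1)
  have hsplit : ∀ j, ∑ φ, f j φ = (m j).descFactorial k * c +
      ∑ φ with ¬ Function.Injective φ, f j φ := by
    intro j
    rw [← Finset.sum_filter_add_sum_filter_not Finset.univ Function.Injective (f j),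
      Finset.sum_congr rfl fun φ hφ => hc j φ (Finset.mem_filter.1 hφ).2, Finset.sum_const,
      card_injective_fin, nsmul_eq_mul]
  have hrest : ∀ j, ∑ φ with ¬ Function.Injective φ, f j φ ≤
      (m j : ℝ) ^ k - (m j).descFactorial k := by
    intro j
    have := Finset.card_filter_add_card_filter_not (s := (Finset.univ : Finset (V → Fin (m j))))
      Function.Injective
    rw [card_injective_fin] at this
    simp only [Finset.card_univ, Fintype.card_fun, Fintype.card_fin] at this
    have h' : (m j : ℝ) ^ k = (m j).descFactorial k +
        (Finset.univ.filter fun φ : V → Fin (m j) => ¬ Function.Injective φ).card := by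
      exact_mod_cast this.symm
    rw [h', add_sub_cancel_left]
    calc _ ≤ ∑ φ : V → Fin (m j) with ¬ Function.Injective φ, (1 : ℝ) :=
          Finset.sum_le_sum fun φ _ => (hf j φ).2
      _ = _ := by simp
  -- The non-injective maps contribute between 0 and their proportion, which tends to 0.
  refine tendsto_of_tendsto_of_tendsto_of_le_of_le' h1 h2 ?_ ?_
  · filter_upwards with j
    rw [hsplit, add_div, mul_div_right_comm]
    exact le_add_of_nonneg_right
      (div_nonneg (Finset.sum_nonneg fun φ _ => (hf j φ).1) (by positivity))
  · filter_upwards [hm.eventually_gt_atTop 0] with j hj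
    have hpos : (0 : ℝ) < (m j : ℝ) ^ k := by positivity
    rw [hsplit, add_div, mul_div_right_comm, one_sub_div hpos.ne']
    gcongr
    exact hrest j

/-! ### Homomorphism densities of the limit -/

open scoped Classical in
/-- The homomorphism density of a graph on an arbitrary finite vertex set. -/
noncomputable def mapDensity {V : Type*} [Fintype V] (F : SimpleGraph V) (G : FinGraph) : ℝ :=
  (∑ φ : V → Fin G.1, if F ≤ G.2.comap φ then (1 : ℝ) else 0) / (G.1 : ℝ) ^ Fintype.card V

lemma mapDensity_fin {k : ℕ} (F : SimpleGraph (Fin k)) (G : FinGraph) :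
    mapDensity F G = homDensity F G := by
  rw [homDensity_eq, mapDensity, Fintype.card_fin]
  congr! 3

/-- Vertices off the range of `ι` are isolated and impose no condition, but they need somewhere to
go, whence the positive order. -/
lemma homDensity_map {V : Type*} [Fintype V] (F : SimpleGraph V) {n : ℕ} (ι : V ↪ Fin n)
    (G : FinGraph) (hG : 0 < G.1) : homDensity (F.map ι) G = mapDensity F G := by
  classical
  have : Nonempty (Fin G.1) := ⟨⟨0, hG⟩⟩
  have := sum_comp_div_pow (M := Fin G.1) ι (fun φ => if F ≤ G.2.comap φ then (1 : ℝ) else 0)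
  simp only [Fintype.card_fin] at this
  rw [homDensity_eq, mapDensity, ← this]
  simp only [SimpleGraph.map_le_iff_le_comap, SimpleGraph.comap_comap]

/-- A map on a disjoint union is an independent pair of maps, and no edges join the two parts. -/
lemma mapDensity_sum {V W : Type*} [Fintype V] [Fintype W] (F : SimpleGraph V)
    (F' : SimpleGraph W) (G : FinGraph) :
    mapDensity (F ⊕g F') G = mapDensity F G * mapDensity F' G := by
  classical
  rw [mapDensity, mapDensity, mapDensity, div_mul_div_comm, Fintype.card_sum, pow_add,
    Finset.sum_mul_sum]
  congr 1
  rw [← Fintype.sum_prod_type' fun (φ : V → Fin G.1) (ψ : W → Fin G.1) =>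
    (if F ≤ G.2.comap φ then (1 : ℝ) else 0) * (if F' ≤ G.2.comap ψ then (1 : ℝ) else 0)]
  refine Finset.sum_equiv (Equiv.sumArrowEquivProdArrow V W (Fin G.1)) (by simp) fun φ _ => ?_
  rw [mul_ite, mul_one, mul_zero, ← ite_and]
  refine if_congr ⟨fun h => ⟨fun a b hab => ?_, fun a b hab => ?_⟩, ?_⟩ rfl rfl
  · exact @h (.inr a) (.inr b) (by simpa using hab)
  · exact @h (.inl a) (.inl b) (by simpa using hab)
  · rintro ⟨h', h⟩ (a | a) (b | b) hab
    · exact h (by simpa using hab)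
    · simp at hab
    · simp at hab
    · exact h' (by simpa using hab)

lemma GraphLimit.t_map_of_tendsto (Γ : GraphLimit) {V : Type*} [Fintype V] (F : SimpleGraph V)
    {n : ℕ} (ι : V ↪ Fin n) {G : ℕ → FinGraph} (hG : ConvergesTo G Γ) {c : ℝ}
    (hc : Tendsto (fun m => mapDensity F (G m)) atTop (𝓝 c)) : Γ.t (F.map ι) = c := by
  refine tendsto_nhds_unique (hG.2 n (F.map ι)) (hc.congr' ?_)
  filter_upwards [hG.1.eventually_gt_atTop 0] with m hm
  exact (homDensity_map F ι (G m) hm).symm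

lemma GraphLimit.t_map (Γ : GraphLimit) {k n : ℕ} (F : SimpleGraph (Fin k)) (ι : Fin k ↪ Fin n) :
    Γ.t (F.map ι) = Γ.t F := by
  obtain ⟨G, hG⟩ := Γ.exists_seq
  exact Γ.t_map_of_tendsto F ι hG ((hG.2 k F).congr fun m => (mapDensity_fin F (G m)).symm)

lemma GraphLimit.t_map_sum (Γ : GraphLimit) {k n : ℕ} (F : SimpleGraph (Fin k))
    (ι : Fin k ⊕ Fin k ↪ Fin n) : Γ.t ((F ⊕g F).map ι) = Γ.t F * Γ.t F := by
  obtain ⟨G, hG⟩ := Γ.exists_seq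
  refine Γ.t_map_of_tendsto _ ι hG (((hG.2 k F).mul (hG.2 k F)).congr fun m => ?_)
  rw [mapDensity_sum, mapDensity_fin]

lemma _root_.PMF.toOuterMeasure_le_one {α : Type*} (p : PMF α) (s : Set α) :
    p.toOuterMeasure s ≤ 1 := by
  rw [← (p.toOuterMeasure_apply_eq_one_iff Set.univ).2 (Set.subset_univ p.support)]
  exact p.toOuterMeasure.mono (Set.subset_univ s)

/-! ### Concentration of the densities of `G(n, Γ)` -/

open scoped Classical in
lemma GraphLimit.sum_inclExcl_mul_indicator (Γ : GraphLimit) {n : ℕ}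
    (A : Set (SimpleGraph (Fin n))) :
    ∑ H : SimpleGraph (Fin n), inclExcl (fun F => Γ.t F) H * (if H ∈ A then 1 else 0) =
      ((Γ.randomGraph n).toOuterMeasure A).toReal := by
  rw [Γ.toReal_randomGraph, Finset.sum_filter]
  simp

open scoped Classical in
/-- If `P(F ⊆ G(n, Γ))` is the same for all embeddings of `F`, then this number is the limit of the
expected density of `F` in `G(n, Γ)`. -/
lemma GraphLimit.tendsto_expectation_mapDensity (Γ : GraphLimit) {V : Type*} [Fintype V]
    (F : SimpleGraph V) {c : ℝ} (hc : ∀ (n : ℕ) (ι : V ↪ Fin n), Γ.t (F.map ι) = c) :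
    Tendsto (fun n => ∑ H : SimpleGraph (Fin n), inclExcl (fun F => Γ.t F) H * mapDensity F ⟨n, H⟩)
      atTop (𝓝 c) := by
  -- Exchanging the two averages turns the expected density into a mean over `φ` of the probability
  -- that `φ` is a homomorphism; this probability is `c` for injective `φ`.
  refine (tendsto_average_of_injective (V := V) tendsto_id
    (fun n φ => ((Γ.randomGraph n).toOuterMeasure {H | F ≤ H.comap φ}).toReal) (c := c)
    (fun n φ => ⟨ENNReal.toReal_nonneg, ?_⟩) (fun n φ hφ => ?_)).congr fun n => ?_
  · exact ENNReal.toReal_le_of_le_ofReal zero_le_one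
      (ENNReal.ofReal_one ▸ (Γ.randomGraph n).toOuterMeasure_le_one _)
  · rw [← hc n ⟨φ, hφ⟩, ← Γ.randomGraph_ge]
    simp only [SimpleGraph.map_le_iff_le_comap]
    rfl
  · simp only [← Γ.sum_inclExcl_mul_indicator, mapDensity, id]
    rw [Finset.sum_comm, Finset.sum_div]
    refine Finset.sum_congr rfl fun H _ => ?_
    rw [← Finset.mul_sum, mul_div_assoc]
    rfl

open scoped Classical in
-- Expanding the square leaves the expected densities of `F` and of `F ⊕g F`, with limits `Γ.t F`
-- and its square, which cancel.
lemma GraphLimit.tendsto_variance_homDensity (Γ : GraphLimit) {k : ℕ} (F : SimpleGraph (Fin k)) :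
    Tendsto (fun n => ∑ H : SimpleGraph (Fin n), inclExcl (fun F => Γ.t F) H *
      (homDensity F ⟨n, H⟩ - Γ.t F) ^ 2) atTop (𝓝 0) := by
  have h1 := Γ.tendsto_expectation_mapDensity F fun n ι => Γ.t_map F ι
  have h2 := Γ.tendsto_expectation_mapDensity (F ⊕g F) fun n ι => Γ.t_map_sum F ι
  have h3 := (h2.sub (h1.const_mul (2 * Γ.t F))).add_const (Γ.t F ^ 2)
  rw [show Γ.t F * Γ.t F - 2 * Γ.t F * Γ.t F + Γ.t F ^ 2 = 0 by ring] at h3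
  refine h3.congr fun n => ?_
  rw [← mul_one (Γ.t F ^ 2), ← Γ.sum_inclExcl n, Finset.mul_sum, Finset.mul_sum,
    ← Finset.sum_sub_distrib, ← Finset.sum_add_distrib]
  refine Finset.sum_congr rfl fun H _ => ?_
  rw [mapDensity_sum, mapDensity_fin]
  ring

/-- `Γ` is a limit of graphs that occur in the random graphs `G(n, Γ)` with positive probability. -/
theorem GraphLimit.exists_convergesTo_support (Γ : GraphLimit) :
    ∃ G : ℕ → FinGraph, (∀ j, (G j).2 ∈ (Γ.randomGraph (G j).1).support) ∧ ConvergesTo G Γ := by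
  classical
  -- One graph must serve all `F` on fewer than `j` vertices; there are finitely many, so their mean
  -- square errors can be summed.
  have key : ∀ j : ℕ, ∃ G : FinGraph, G.2 ∈ (Γ.randomGraph G.1).support ∧ j ≤ G.1 ∧
      ∑ k ∈ Finset.range j, ∑ F : SimpleGraph (Fin k), (homDensity F G - Γ.t F) ^ 2
        < 1 / ((j : ℝ) + 1) := by
    intro j
    have hlim : Tendsto (fun n => ∑ k ∈ Finset.range j, ∑ F : SimpleGraph (Fin k),
        ∑ H : SimpleGraph (Fin n), inclExcl (fun F => Γ.t F) H *
          (homDensity F ⟨n, H⟩ - Γ.t F) ^ 2) atTop (𝓝 0) := by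
      have := tendsto_finsetSum (Finset.range j) fun k _ => tendsto_finsetSum Finset.univ
        fun (F : SimpleGraph (Fin k)) _ => Γ.tendsto_variance_homDensity F
      simpa using this
    have hpos : (0 : ℝ) < 1 / ((j : ℝ) + 1) := by positivity
    obtain ⟨n, hn, hjn⟩ := ((hlim.eventually_lt_const hpos).and (eventually_ge_atTop j)).exists
    -- Otherwise every graph of positive weight has error at least the bound, and so does the
    -- average.
    by_contra! hcon
    refine absurd hn (not_lt.2 ?_)
    have hswap : ∑ k ∈ Finset.range j, ∑ F : SimpleGraph (Fin k),
        ∑ H : SimpleGraph (Fin n), inclExcl (fun F => Γ.t F) H *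
          (homDensity F ⟨n, H⟩ - Γ.t F) ^ 2 =
        ∑ H : SimpleGraph (Fin n), inclExcl (fun F => Γ.t F) H *
          ∑ k ∈ Finset.range j, ∑ F : SimpleGraph (Fin k), (homDensity F ⟨n, H⟩ - Γ.t F) ^ 2 := by
      simp only [Finset.mul_sum]
      rw [Finset.sum_comm]
      exact Finset.sum_congr rfl fun k _ => Finset.sum_comm
    have hone := congrArg (· * (1 / ((j : ℝ) + 1))) (Γ.sum_inclExcl n)
    simp only [one_mul, Finset.sum_mul] at hone
    rw [hswap, ← hone]
    refine Finset.sum_le_sum fun H _ => ?_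
    rcases (Γ.inclExcl_nonneg H).eq_or_lt with h0 | h0
    · simp [← h0]
    · refine mul_le_mul_of_nonneg_left (hcon ⟨n, H⟩ ?_ hjn) h0.le
      intro hz
      rw [← Γ.randomGraph_apply, hz] at h0
      simp at h0
  choose G hsupp hle hsmall using key
  refine ⟨G, hsupp, tendsto_atTop_mono hle tendsto_id, fun k F => ?_⟩
  have hsq : Tendsto (fun j => (homDensity F (G j) - Γ.t F) ^ 2) atTop (𝓝 0) := by
    refine tendsto_of_tendsto_of_tendsto_of_le_of_le' tendsto_const_nhds
      tendsto_one_div_add_atTop_nhds_zero_nat (Eventually.of_forall fun j => sq_nonneg _) ?_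
    filter_upwards [eventually_gt_atTop k] with j hj
    refine le_trans ?_ (hsmall j).le
    refine le_trans ?_ (Finset.single_le_sum (fun i _ => Finset.sum_nonneg fun F _ => sq_nonneg _)
      (Finset.mem_range.2 hj))
    exact Finset.single_le_sum (f := fun F : SimpleGraph (Fin k) =>
      (homDensity F (G j) - Γ.t F) ^ 2) (fun F _ => sq_nonneg _) (Finset.mem_univ F)
  have habs := hsq.sqrt
  simp only [Real.sqrt_sq_eq_abs, Real.sqrt_zero] at habs
  simpa using ((tendsto_zero_iff_abs_tendsto_zero _).2 habs).add_const (Γ.t F)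

/-! ### Hereditary properties of the random graphs -/

/-- A sample equal to `H` restricts along `ι` to a smaller sample equal to `H.comap ι`. -/
lemma inclExcl_homDensity_le_comap {k n : ℕ} (ι : Fin k ↪ Fin n) (H : SimpleGraph (Fin n))
    (G : FinGraph) (hG : 0 < G.1) :
    inclExcl (fun F => homDensity F G) H ≤ inclExcl (fun F => homDensity F G) (H.comap ι) := by
  classical
  have : Nonempty (Fin G.1) := ⟨⟨0, hG⟩⟩
  have := sum_comp_div_pow (M := Fin G.1) ι (fun φ => if G.2.comap φ = H.comap ι then (1 : ℝ) else 0)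
  simp only [Fintype.card_fin] at this
  rw [inclExcl_homDensity, inclExcl_homDensity, ← this]
  gcongr with φ
  split_ifs with h1 h2 h2
  · rfl
  · exact absurd (by rw [← h1, SimpleGraph.comap_comap]) h2
  · exact zero_le_one
  · rfl

/-- Induced subgraphs of `G(n, Γ)` are distributed as `G(k, Γ)`; stated for the supports. -/
lemma GraphLimit.comap_mem_support (Γ : GraphLimit) {k n : ℕ} (ι : Fin k ↪ Fin n)
    {H : SimpleGraph (Fin n)} (hH : H ∈ (Γ.randomGraph n).support) :
    H.comap ι ∈ (Γ.randomGraph k).support := by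
  obtain ⟨G, hG⟩ := Γ.exists_seq
  have hle : inclExcl (fun F => Γ.t F) H ≤ inclExcl (fun F => Γ.t F) (H.comap ι) := by
    refine le_of_tendsto_of_tendsto (ConvergesTo.tendsto_inclExcl (Γ := Γ) hG H)
      (ConvergesTo.tendsto_inclExcl (Γ := Γ) hG (H.comap ι)) ?_
    filter_upwards [hG.1.eventually_gt_atTop 0] with m hm
    exact inclExcl_homDensity_le_comap ι H (G m) hm
  intro hz
  rw [← Γ.randomGraph_apply, ← Γ.randomGraph_apply, hz, ENNReal.toReal_zero] at hle
  exact hH (((ENNReal.toReal_eq_zero_iff _).1 (hle.antisymm ENNReal.toReal_nonneg)).resolve_right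
    (PMF.apply_ne_top _ _))

/-- Graphs in the support of `G(n, Γ)` are induced subgraphs of the members of any sequence that
converges to `Γ`. -/
lemma ConvergesTo.exists_comap_eq {G : ℕ → FinGraph} {Γ : GraphLimit} (hG : ConvergesTo G Γ)
    {n : ℕ} {H : SimpleGraph (Fin n)} (hH : H ∈ (Γ.randomGraph n).support) :
    ∃ (m : ℕ) (φ : Fin n → Fin (G m).1), Function.Injective φ ∧ (G m).2.comap φ = H := by
  classical
  by_contra! hcon
  -- Only non-injective samples could then yield `H`, so its probability would be 0 in the limit.
  have h0 := tendsto_average_of_injective (V := Fin n) hG.1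
    (fun m φ => if (G m).2.comap φ = H then (1 : ℝ) else 0) (c := 0)
    (fun m φ => by split_ifs <;> simp) (fun m φ hφ => if_neg (hcon m φ hφ))
  have h1 := hG.tendsto_inclExcl H
  simp only [inclExcl_homDensity] at h1
  rw [Fintype.card_fin] at h0
  have h2 := tendsto_nhds_unique h1 h0
  rw [← Γ.randomGraph_apply] at h2
  exact hH (((ENNReal.toReal_eq_zero_iff _).1 h2).resolve_right (PMF.apply_ne_top _ _))

/-! ### Absence of claws in graphs and in supports. -/

lemma IsUnitIntervalGraph.isEmpty_claw_embedding {V : Type*} {G : SimpleGraph V}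
    (hG : IsUnitIntervalGraph G) :
    IsEmpty (completeBipartiteGraph (Fin 1) (Fin 3) ↪g G) := by
  refine ⟨fun e => not_isUnitIntervalGraph_claw ?_⟩
  rw [← SimpleGraph.Embedding.comap_eq e]
  exact IsIntersectionGraph.comap hG e.injective

lemma indDensity_claw_eq_zero {G : FinGraph} (hG : IsUnitIntervalGraph G.2) :
    indDensity (completeBipartiteGraph (Fin 1) (Fin 3)) G = 0 := by
  have : IsEmpty {s : Finset (Fin G.1) // s.card = Fintype.card (Fin 1 ⊕ Fin 3) ∧
      Nonempty (G.2.induce (s : Set (Fin G.1)) ≃g completeBipartiteGraph (Fin 1) (Fin 3))} := by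
    refine ⟨?_⟩
    rintro ⟨s, -, ⟨e⟩⟩
    exact hG.isEmpty_claw_embedding.false
      (e.symm.toEmbedding.trans (SimpleGraph.Embedding.induce _))
  rw [indDensity, Nat.card_of_isEmpty, Nat.cast_zero, zero_div]

/-- Restricting `H` along an embedding would put a copy of `F` in the support of the smaller random
graph, giving `F` positive induced density. -/
lemma GraphLimit.isEmpty_embedding_of_indDensity_eq_zero {Γ : GraphLimit} {V : Type*} [Fintype V]
    {F : SimpleGraph V} (h : Γ.indDensity F = 0) {n : ℕ} {H : SimpleGraph (Fin n)}
    (hH : H ∈ (Γ.randomGraph n).support) : IsEmpty (F ↪g H) := by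
  refine ⟨fun e => ?_⟩
  let f := (Fintype.equivFin V).symm
  have hmem := Γ.comap_mem_support (f.toEmbedding.trans e.toEmbedding) hH
  have h0 : (Γ.randomGraph (Fintype.card V)).toOuterMeasure {K | Nonempty (K ≃g F)} = 0 := by
    rw [GraphLimit.indDensity, ENNReal.toReal_eq_zero_iff] at h
    exact h.resolve_right (ne_top_of_le_ne_top ENNReal.one_ne_top (PMF.toOuterMeasure_le_one _ _))
  rw [PMF.toOuterMeasure_apply_eq_zero_iff] at h0
  exact Set.disjoint_left.1 h0 hmem ⟨⟨f, e.map_rel_iff.symm⟩⟩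

end GraphLimits

/-- Characterization of unit interval graph limits. -/
theorem theorem10p2 (Γ : GraphLimits.GraphLimit) :
    List.TFAE [
      GraphLimits.IsUnitIntervalGraphLimit Γ,
      GraphLimits.IsIntervalGraphLimit Γ ∧
        Γ.indDensity (completeBipartiteGraph (Fin 1) (Fin 3)) = 0,
      ∀ n : ℕ, (Γ.randomGraph n).toOuterMeasure
        {H : SimpleGraph (Fin n) | GraphLimits.IsUnitIntervalGraph H} = 1] := by
  tfae_have 1 → 2 := by
    rintro ⟨G, hG, hconv⟩
    refine ⟨⟨G, fun m => (hG m).isIntervalGraph, hconv⟩, ?_⟩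
    refine tendsto_nhds_unique (hconv.tendsto_indDensity _) (tendsto_const_nhds.congr fun m => ?_)
    exact (GraphLimits.indDensity_claw_eq_zero (hG m)).symm
  tfae_have 2 → 3 := by
    rintro ⟨⟨G, hG, hconv⟩, hclaw⟩ n
    -- For a discrete law, probability one means that the whole support has the property.
    rw [PMF.toOuterMeasure_apply_eq_one_iff]
    intro H hH
    obtain ⟨m, φ, hφ, rfl⟩ := hconv.exists_comap_eq hH
    exact GraphLimits.IsIntervalGraph.isUnitIntervalGraph
      (GraphLimits.IsIntersectionGraph.comap (hG m) hφ)
      (GraphLimits.GraphLimit.isEmpty_embedding_of_indDensity_eq_zero hclaw hH)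
  tfae_have 3 → 1 := by
    intro h
    obtain ⟨G, hG, hconv⟩ := Γ.exists_convergesTo_support
    exact ⟨G, fun j => (PMF.toOuterMeasure_apply_eq_one_iff _ _).1 (h _) (hG j), hconv⟩
  tfae_finish
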